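/- Let $n\ge 3$ be an integer. There exists a constant $C(n)>0$, depending only on $n$, such that every convex $n$-gon $P\subset\mathbb{R}^2$ satisfies $$\sigma_s^2(P)+\sigma_r^2(P)\le C(n)\,\delta(P).$$ Here $P$ has pairwise distinct vertices $A_1,\dots,A_n$, not all collinear, in cyclic order ($A_{n+1}=A_1$), and is convex in the sense that, traversed in this order, it lies entirely in the closed left half-plane of every side, or entirely in the closed right half-plane of every side (angles equal to $\pi$ are allowed). Put $l_i=|A_iA_{i+1}|$, $O=\frac1n\sum_{i=1}^n A_i$ and $r_i=|OA_i|$. Then $L(P)=\sum_{i=1}^n l_i$ is the perimeter, $F(P)$ is the area enclosed by $P$, $$\sigma_s^2(P)=\frac1n\sum_{i=1}^n l_i^2-\frac1{n^2}L(P)^2,\qquad \sigma_r^2(P)=\frac1n\sum_{i=1}^n r_i^2-\frac1{n^2}\Big(\sum_{i=1}^n r_i\Big)^2,$$ and $\delta(P)=L(P)^2-4n\tan\frac{\pi}{n}\,F(P)$ is the polygonal isoperimetric deficit. -/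

import Mathlib

open MeasureTheory

noncomputable section

namespace PlanePolygon

/-- The Euclidean plane. -/
abbrev Plane : Type := EuclideanSpace ℝ (Fin 2)

/-- The planar cross product `u × v`; it is nonnegative iff `v` lies weakly to the left of `u`. -/
def cross (u v : Plane) : ℝ := u 0 * v 1 - u 1 * v 0

variable {n : ℕ}

/-- An `n`-gon with cyclically ordered vertices `P 0, …, P (n - 1)` is convex if its vertices are
pairwise distinct and not all on one line, and the polygon, traversed in this order, lies entirely
on the left of each of its sides (counterclockwise order) or entirely on the right of each of its
sides (clockwise order). Angles equal to `π` are allowed. -/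
def IsConvex (P : Polygon Plane n) : Prop :=
  Function.Injective P.vertices ∧
  ¬ Collinear ℝ (Set.range P.vertices) ∧
  ((∀ i j : Fin n, 0 ≤ cross (P (finRotate n i) - P i) (P j - P i)) ∨
   (∀ i j : Fin n, cross (P (finRotate n i) - P i) (P j - P i) ≤ 0))

/-- The length of the side joining the `i`-th vertex to the next one in cyclic order. -/
def sideLength (P : Polygon Plane n) (i : Fin n) : ℝ := dist (P i) (P (finRotate n i))

/-- The perimeter `L(P)`. -/
def perimeter (P : Polygon Plane n) : ℝ := ∑ i, sideLength P i

/-- The sum of the squares of the side lengths, `S(P)`. -/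
def sumSqSides (P : Polygon Plane n) : ℝ := ∑ i, sideLength P i ^ 2

/-- The centre of mass of the vertices. -/
def center (P : Polygon Plane n) : Plane := (n : ℝ)⁻¹ • ∑ i, P i

/-- The `i`-th radius: the distance from the centre of mass to the `i`-th vertex. -/
def radius (P : Polygon Plane n) (i : Fin n) : ℝ := dist (center P) (P i)

/-- The area `F(P)` of a convex polygon: the Lebesgue measure of the region it encloses, which is
the convex hull of its vertices. -/
def convexArea (P : Polygon Plane n) : ℝ :=
  volume.real (convexHull ℝ (Set.range P.vertices))

/-- The variance of the side lengths. -/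
def sideVariance (P : Polygon Plane n) : ℝ :=
  1 / (n : ℝ) * sumSqSides P - 1 / (n : ℝ) ^ 2 * perimeter P ^ 2

/-- The variance of the radii. -/
def radiusVariance (P : Polygon Plane n) : ℝ :=
  1 / (n : ℝ) * ∑ i, radius P i ^ 2 - 1 / (n : ℝ) ^ 2 * (∑ i, radius P i) ^ 2

/-- The polygonal isoperimetric deficit of a convex `n`-gon. -/
def deficit (P : Polygon Plane n) : ℝ :=
  perimeter P ^ 2 - 4 * n * Real.tan (Real.pi / n) * convexArea P

end PlanePolygon

end

namespace ComplexPolygon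

open Complex ZMod Finset ComplexConjugate

/-! The polygon is viewed as a function `z` on `ZMod n` with values in `ℂ`, and all estimates use
the signed shoelace area. The discrete Fourier transform diagonalises the form `sqSides - 4 * tan (π
/ n) * area`. Its eigenvalues `gap k` vanish for `k = 0, 1` (translations and regular polygons) and
are positive otherwise, so the form controls the squared distance to a regular polygon
(`exists_wirtinger`), and with it `radVar`. Since `n` times the form equals `n ^ 2 * sideVar +
signedDeficit` (`mul_sqSides_sub_area`), it remains to bound `sideVar` by the deficit.

For this, a vertex is moved so that its two sides become equal while the perimeter is kept. The area
gained is at least `√(m² - b²) d² / 8`, where `m` and `d` are the sum and difference of the two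
sides and `b` is the distance between the neighbours (`area_add_gain_le`; perimeter one). Applied to
an area maximiser, which exists by compactness, this shows that it is equilateral, and the Fourier
inequality then yields the isoperimetric inequality. Applied to an arbitrary polygon, with the sharp
constant now known, it bounds `d²` by the deficit as long as `m² - b²` stays away from zero. The
polygons with an almost flat angle form a compact set after normalisation. The deficit is positive
there, because equality forces regularity, so the quotient is bounded.

Finally, a fan triangulation bounds the area of the convex hull by the shoelace area. This direction
suffices, as it makes the true deficit at least the signed one. -/

lemma cos_pi_div_pos {n : ℕ} (hn : 3 ≤ n) : 0 < Real.cos (Real.pi / n) := by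
  have h : (3 : ℝ) ≤ n := by exact_mod_cast hn
  apply Real.cos_pos_of_mem_Ioo
  constructor
  · have : 0 < Real.pi / n := by positivity
    linarith [Real.pi_pos]
  · exact div_lt_div_of_pos_left Real.pi_pos (by norm_num) (by linarith)

lemma sin_pi_div_pos {n : ℕ} (hn : 3 ≤ n) : 0 < Real.sin (Real.pi / n) := by
  have h : (3 : ℝ) ≤ n := by exact_mod_cast hn
  apply Real.sin_pos_of_pos_of_lt_pi (by positivity)
  exact div_lt_self Real.pi_pos (by linarith)

lemma tan_pi_div_pos {n : ℕ} (hn : 3 ≤ n) : 0 < Real.tan (Real.pi / n) := by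
  rw [Real.tan_eq_sin_div_cos]
  exact div_pos (sin_pi_div_pos hn) (cos_pi_div_pos hn)

lemma val_one_of_three_le {n : ℕ} (hn : 3 ≤ n) : (1 : ZMod n).val = 1 := by
  have : Fact (1 < n) := ⟨by lia⟩
  exact ZMod.val_one n

/-! ### The triangle cut off at a vertex. -/

section

variable {n : ℕ}

/-- The sum of the lengths of the two sides at the vertex `i`. -/
noncomputable def sidesAt (z : ZMod n → ℂ) (i : ZMod n) : ℝ := ‖z i - z (i - 1)‖ + ‖z (i + 1) - z i‖

/-- The difference of the lengths of the two sides at the vertex `i`. -/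
noncomputable def sideDiff (z : ZMod n → ℂ) (i : ZMod n) : ℝ :=
  ‖z i - z (i - 1)‖ - ‖z (i + 1) - z i‖

/-- The distance between the two neighbours of the vertex `i`. -/
noncomputable def base (z : ZMod n → ℂ) (i : ZMod n) : ℝ := ‖z (i + 1) - z (i - 1)‖

/-- The signed area of the triangle spanned by the vertex `i` and its neighbours. -/
noncomputable def ear (z : ZMod n → ℂ) (i : ZMod n) : ℝ :=
  ((conj (z (i - 1)) * z i).im + (conj (z i) * z (i + 1)).im
    - (conj (z (i - 1)) * z (i + 1)).im) / 2

/-- Replace the vertex `i` by the apex of an isosceles triangle over the segment joining its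
neighbours, whose height is `s` times the length of that segment. -/
noncomputable def raise (z : ZMod n → ℂ) (i : ZMod n) (s : ℝ) : ZMod n → ℂ :=
  Function.update z i ((z (i - 1) + z (i + 1)) / 2 + I * s * (z (i - 1) - z (i + 1)))

lemma base_nonneg (z : ZMod n → ℂ) (i : ZMod n) : 0 ≤ base z i := norm_nonneg _

lemma abs_sideDiff_le (z : ZMod n → ℂ) (i : ZMod n) : |sideDiff z i| ≤ base z i := by
  have h := abs_norm_sub_norm_le (z i - z (i - 1)) (z i - z (i + 1))
  rwa [norm_sub_rev (z i) (z (i + 1)), sub_sub_sub_cancel_left] at h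

lemma base_le_sidesAt (z : ZMod n → ℂ) (i : ZMod n) : base z i ≤ sidesAt z i := by
  have h := norm_add_le (z i - z (i - 1)) (z (i + 1) - z i)
  rwa [add_comm, sub_add_sub_cancel] at h

/-- Heron's formula, with the two sides at the vertex entering through their sum and difference. -/
lemma sixteen_mul_ear_sq (z : ZMod n → ℂ) (i : ZMod n) :
    16 * ear z i ^ 2 =
      (sidesAt z i ^ 2 - base z i ^ 2) * (base z i ^ 2 - sideDiff z i ^ 2) := by
  have hX : ‖z i - z (i - 1)‖ ^ 2 = _ := (normSq_eq_norm_sq _).symm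
  have hY : ‖z (i + 1) - z i‖ ^ 2 = _ := (normSq_eq_norm_sq _).symm
  have hB : ‖z (i + 1) - z (i - 1)‖ ^ 2 = _ := (normSq_eq_norm_sq _).symm
  rw [normSq_apply] at hX hY hB
  have key : (sidesAt z i ^ 2 - base z i ^ 2) * (base z i ^ 2 - sideDiff z i ^ 2) =
      4 * ‖z i - z (i - 1)‖ ^ 2 * ‖z (i + 1) - z i‖ ^ 2 -
        (‖z i - z (i - 1)‖ ^ 2 + ‖z (i + 1) - z i‖ ^ 2 - ‖z (i + 1) - z (i - 1)‖ ^ 2) ^ 2 := by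
    simp only [sidesAt, base, sideDiff]
    ring
  rw [key, hX, hY, hB]
  simp only [ear, mul_im, conj_re, conj_im, sub_re, sub_im]
  ring

end

/-! ### Fourier analysis of closed polygons and the discrete Wirtinger inequality. -/

variable {n : ℕ} [NeZero n]

/-- The length of the closed polygonal line with vertices `z j`. -/
noncomputable def perim (z : ZMod n → ℂ) : ℝ := ∑ j, ‖z (j + 1) - z j‖

/-- The sum of the squared side lengths. -/
noncomputable def sqSides (z : ZMod n → ℂ) : ℝ := ∑ j, ‖z (j + 1) - z j‖ ^ 2

/-- The signed area given by the shoelace formula. -/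
noncomputable def area (z : ZMod n → ℂ) : ℝ := (∑ j, (conj (z j) * z (j + 1)).im) / 2

/-- The centre of mass of the vertices. -/
noncomputable def centroid (z : ZMod n → ℂ) : ℂ := (n : ℂ)⁻¹ * ∑ j, z j

/-- The closed polygonal line with Fourier coefficients `a`. -/
noncomputable def synth (a : ZMod n → ℂ) (j : ZMod n) : ℂ := ∑ k, a k * stdAddChar (j * k)

lemma conj_stdAddChar (k : ZMod n) : conj (stdAddChar k) = stdAddChar (-k) := by
  rw [stdAddChar_apply, stdAddChar_apply, AddChar.map_neg_eq_inv, ← Circle.coe_inv_eq_conj]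

/-- Parseval's identity, from the orthogonality of characters. -/
lemma sum_conj_synth_mul_synth (a b : ZMod n → ℂ) :
    ∑ j, conj (synth a j) * synth b j = n * ∑ k, conj (a k) * b k := by
  have h1 (k l : ZMod n) : ∑ j : ZMod n, stdAddChar (j * (l - k)) = if l = k then (n : ℂ) else 0 := by
    rw [AddChar.sum_mulShift _ (isPrimitive_stdAddChar n)]
    simp [sub_eq_zero, ZMod.card]
  have h2 (j k l : ZMod n) : conj (a k * stdAddChar (j * k)) * (b l * stdAddChar (j * l)) =
      conj (a k) * b l * stdAddChar (j * (l - k)) := by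
    rw [map_mul, conj_stdAddChar, mul_sub, sub_eq_neg_add, AddChar.map_add_eq_mul]
    ring
  simp only [synth, map_sum, Finset.sum_mul_sum, h2]
  rw [Finset.sum_comm]
  simp_rw [Finset.sum_comm (s := (univ : Finset (ZMod n))) (t := univ)
    (f := fun j l ↦ _ * stdAddChar (j * (l - _))), ← Finset.mul_sum, h1]
  simp [Finset.mul_sum, mul_comm, mul_left_comm]

lemma sum_norm_sq_synth (a : ZMod n → ℂ) : ∑ j, ‖synth a j‖ ^ 2 = n * ∑ k, ‖a k‖ ^ 2 := by
  have h := sum_conj_synth_mul_synth a a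
  simp only [conj_mul'] at h
  exact_mod_cast h

lemma synth_add_one (a : ZMod n → ℂ) (j : ZMod n) :
    synth a (j + 1) = synth (fun k ↦ a k * stdAddChar k) j := by
  simp only [synth, add_mul, one_mul, AddChar.map_add_eq_mul]
  exact Finset.sum_congr rfl fun k _ ↦ by ring

lemma exists_eq_synth (z : ZMod n → ℂ) : ∃ a, z = synth a := by
  refine ⟨fun k ↦ (n : ℂ)⁻¹ * dft z k, ?_⟩
  have h := dft.symm_apply_apply z
  ext j
  conv_lhs => rw [← h, invDFT_apply]
  simp only [synth, smul_eq_mul, Finset.mul_sum]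
  exact Finset.sum_congr rfl fun k _ ↦ by rw [mul_comm j k]; ring

lemma centroid_synth (a : ZMod n → ℂ) : centroid (synth a) = a 0 := by
  simp only [centroid, synth]
  rw [Finset.sum_comm]
  simp_rw [← Finset.mul_sum, AddChar.sum_mulShift _ (isPrimitive_stdAddChar n)]
  simp [ZMod.card, mul_comm (a 0), NeZero.ne n]

lemma sum_conj_mul_succ_synth (a : ZMod n → ℂ) :
    ∑ j, conj (synth a j) * synth a (j + 1) = n * ∑ k, (‖a k‖ ^ 2 : ℝ) * stdAddChar k := by
  simp only [synth_add_one, sum_conj_synth_mul_synth, ← mul_assoc, conj_mul']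
  simp

lemma sum_add_one {M : Type*} [AddCommMonoid M] (f : ZMod n → M) : ∑ j, f (j + 1) = ∑ j, f j :=
  Equiv.sum_comp (Equiv.addRight (1 : ZMod n)) f

lemma sqSides_eq (z : ZMod n → ℂ) :
    sqSides z = 2 * ∑ j, ‖z j‖ ^ 2 - 2 * (∑ j, conj (z j) * z (j + 1)).re := by
  have h (j : ZMod n) : ‖z (j + 1) - z j‖ ^ 2 =
      ‖z (j + 1)‖ ^ 2 + ‖z j‖ ^ 2 - 2 * (conj (z j) * z (j + 1)).re := by
    simp only [← normSq_eq_norm_sq, normSq_sub]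
    rw [mul_comm (z (j + 1))]
  simp only [sqSides, h, Finset.sum_sub_distrib, Finset.sum_add_distrib, ← Finset.mul_sum, re_sum]
  rw [sum_add_one fun j ↦ ‖z j‖ ^ 2]
  ring

/-- The eigenvalues of the quadratic form `sqSides - 4 * tan (π / n) * area`. -/
noncomputable def gap (k : ZMod n) : ℝ :=
  2 - 2 * (stdAddChar k).re - 2 * Real.tan (Real.pi / n) * (stdAddChar k).im

lemma sqSides_sub_area_synth (a : ZMod n → ℂ) :
    sqSides (synth a) - 4 * Real.tan (Real.pi / n) * area (synth a) =
      n * ∑ k, ‖a k‖ ^ 2 * gap k := by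
  rw [sqSides_eq, area, ← im_sum, sum_conj_mul_succ_synth, sum_norm_sq_synth]
  simp only [← ofReal_natCast, re_ofReal_mul, im_ofReal_mul, re_sum, im_sum, gap, mul_sub,
    Finset.sum_sub_distrib, Finset.mul_sum, Finset.sum_div]
  rw [← Finset.sum_sub_distrib, ← Finset.sum_sub_distrib, ← Finset.sum_sub_distrib,
    ← Finset.sum_sub_distrib]
  exact Finset.sum_congr rfl fun k _ ↦ by ring

lemma stdAddChar_re_im (k : ZMod n) : (stdAddChar k).re = Real.cos (2 * (Real.pi * k.val / n)) ∧
    (stdAddChar k).im = Real.sin (2 * (Real.pi * k.val / n)) := by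
  have h : (stdAddChar k : ℂ) = cexp ((2 * (Real.pi * k.val / n) : ℝ) * I) := by
    rw [stdAddChar_apply, toCircle_apply]
    push_cast
    ring_nf
  rw [h, exp_ofReal_mul_I_re, exp_ofReal_mul_I_im]
  exact ⟨rfl, rfl⟩

/-- The factored form shows the sign: one sine vanishes at `k = 0`, the other at `k = 1`, and for `2
≤ k < n` both arguments lie in `(0, π)`. -/
lemma gap_eq (hn : 3 ≤ n) (k : ZMod n) : gap k =
    4 * Real.sin (Real.pi * k.val / n) * Real.sin (Real.pi * k.val / n - Real.pi / n) /
      Real.cos (Real.pi / n) := by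
  have h := (cos_pi_div_pos hn).ne'
  rw [gap, (stdAddChar_re_im k).1, (stdAddChar_re_im k).2, Real.sin_sub, Real.sin_two_mul,
    Real.cos_two_mul, Real.tan_eq_sin_div_cos]
  field_simp
  rw [Real.cos_sq']
  ring

lemma gap_zero (hn : 3 ≤ n) : gap (0 : ZMod n) = 0 := by simp [gap_eq hn]

lemma gap_one (hn : 3 ≤ n) : gap (1 : ZMod n) = 0 := by simp [gap_eq hn, val_one_of_three_le hn]

lemma gap_pos (hn : 3 ≤ n) {k : ZMod n} (h0 : k ≠ 0) (h1 : k ≠ 1) : 0 < gap k := by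
  have hn' : (0 : ℝ) < n := by positivity
  have hk : 2 ≤ k.val := by
    have h0' : k.val ≠ 0 := by simpa using h0
    have h1' : k.val ≠ 1 := fun h ↦ h1 <| ZMod.val_injective n <| by
      rw [h, val_one_of_three_le hn]
    lia
  have hk2 : (2 : ℝ) ≤ k.val := by exact_mod_cast hk
  have hkn : (k.val : ℝ) < n := by exact_mod_cast ZMod.val_lt k
  have hlt : Real.pi * k.val / n < Real.pi := by
    rw [div_lt_iff₀ hn']
    exact mul_lt_mul_of_pos_left hkn Real.pi_pos
  have hgt : Real.pi / n < Real.pi * k.val / n := by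
    rw [div_lt_div_iff_of_pos_right hn']
    nlinarith [Real.pi_pos]
  have hpos : 0 < Real.pi / n := by positivity
  rw [gap_eq hn]
  have := cos_pi_div_pos hn
  have := Real.sin_pos_of_pos_of_lt_pi (hpos.trans hgt) hlt
  have := Real.sin_pos_of_pos_of_lt_pi (sub_pos.2 hgt) (by linarith)
  positivity

/-- A quantitative discrete Wirtinger inequality: the defect controls the distance to the
regular polygons. -/
theorem exists_wirtinger (hn : 3 ≤ n) : ∃ c : ℝ, 0 < c ∧ ∀ z : ZMod n → ℂ, ∃ b : ℂ,
    c * ∑ j, ‖z j - centroid z - b * stdAddChar j‖ ^ 2 ≤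
      sqSides z - 4 * Real.tan (Real.pi / n) * area z := by
  obtain ⟨c, hc, hgap⟩ : ∃ c : ℝ, 0 < c ∧ ∀ k : ZMod n, k ≠ 0 → k ≠ 1 → c ≤ gap k := by
    obtain h | h := (univ.filter fun k : ZMod n ↦ k ≠ 0 ∧ k ≠ 1).eq_empty_or_nonempty
    · refine ⟨1, one_pos, fun k h0 h1 ↦ ?_⟩
      have : k ∈ univ.filter fun k : ZMod n ↦ k ≠ 0 ∧ k ≠ 1 := by simp [h0, h1]
      simp [h] at this
    · obtain ⟨k, hk, hmin⟩ := Finset.exists_min_image _ gap h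
      simp only [mem_filter, mem_univ, true_and] at hk hmin
      exact ⟨gap k, gap_pos hn hk.1 hk.2, fun l h0 h1 ↦ hmin l ⟨h0, h1⟩⟩
  refine ⟨c, hc, fun z ↦ ?_⟩
  obtain ⟨a, rfl⟩ := exists_eq_synth z
  have h01 : (0 : ZMod n) ≠ 1 := fun h ↦ by
    have := val_one_of_three_le hn
    rw [← h] at this
    simp at this
  have hrem (j : ZMod n) : synth a j - centroid (synth a) - a 1 * stdAddChar j =
      synth (fun k ↦ if k = 0 ∨ k = 1 then 0 else a k) j := by
    rw [centroid_synth]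
    simp only [synth]
    have hsplit (k : ZMod n) : (if k = 0 ∨ k = 1 then 0 else a k) * stdAddChar (j * k) =
        a k * stdAddChar (j * k) - (if k = 0 then a 0 else 0)
          - (if k = 1 then a 1 * stdAddChar j else 0) := by
      by_cases h0 : k = 0
      · simp [h0, h01]
      · by_cases h1 : k = 1 <;> simp [h0, h1, h01.symm]
    simp [hsplit, Finset.sum_sub_distrib]
  -- The nearest regular polygon is given by the first Fourier coefficient.
  refine ⟨a 1, ?_⟩
  simp only [hrem]
  rw [sum_norm_sq_synth, sqSides_sub_area_synth, mul_left_comm, Finset.mul_sum]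
  refine mul_le_mul_of_nonneg_left (Finset.sum_le_sum fun k _ ↦ ?_) (Nat.cast_nonneg n)
  by_cases h0 : k = 0
  · simp [h0, gap_zero hn]
  by_cases h1 : k = 1
  · simp [h1, gap_one hn]
  simp only [h0, h1, or_self, if_false]
  rw [mul_comm]
  refine mul_le_mul_of_nonneg_left ?_ (by positivity)
  exact hgap k h0 h1

/-! ### Isosceles symmetrisation at a vertex. -/

/-- Only the terms `j = i - 1` and `j = i` involve the vertex `i`. Leaving `f` general serves both
perimeter and area. -/
lemma sum_update_succ (hn : 3 ≤ n) (f : ℂ → ℂ → ℝ) (z : ZMod n → ℂ) (i : ZMod n) (a : ℂ) :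
    ∑ j, f (Function.update z i a j) (Function.update z i a (j + 1)) =
      ∑ j, f (z j) (z (j + 1)) +
        (f (z (i - 1)) a - f (z (i - 1)) (z i) + (f a (z (i + 1)) - f (z i) (z (i + 1)))) := by
  have : Fact (1 < n) := ⟨by lia⟩
  have h1 : i - 1 ≠ i := by simp
  have h2 : i + 1 ≠ i := by simp
  rw [← sub_eq_iff_eq_add', ← Finset.sum_sub_distrib,
    Fintype.sum_eq_add (i - 1) i h1]
  · simp [h1, h2]
  · rintro j ⟨hj1, hj2⟩
    have : j + 1 ≠ i := fun h ↦ hj1 (eq_sub_of_add_eq h)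
    simp [this, hj2]

lemma perim_raise (hn : 3 ≤ n) (z : ZMod n → ℂ) (i : ZMod n) (s : ℝ) :
    perim (raise z i s) = perim z - sidesAt z i + base z i * √(1 + 4 * s ^ 2) := by
  have hs : ‖(1 / 2 + I * s : ℂ)‖ = √(1 + 4 * s ^ 2) / 2 := by
    have : (1 / 2 + I * s : ℂ) = ((1 / 2 : ℝ) : ℂ) + (s : ℝ) * I := by push_cast; ring
    rw [this, norm_add_mul_I]
    rw [← Real.sqrt_sq (show (0 : ℝ) ≤ 2 by norm_num), ← Real.sqrt_div (by positivity)]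
    congr 1
    ring
  have hs' : ‖(1 / 2 - I * s : ℂ)‖ = √(1 + 4 * s ^ 2) / 2 := by
    rw [← hs, ← Complex.norm_conj]
    congr 1
    simp only [map_sub, map_mul, map_div₀, map_one, map_ofNat, conj_I, conj_ofReal]
    ring
  have h := sum_update_succ hn (fun u v ↦ ‖v - u‖) z i
    ((z (i - 1) + z (i + 1)) / 2 + I * s * (z (i - 1) - z (i + 1)))
  have e1 : (z (i - 1) + z (i + 1)) / 2 + I * s * (z (i - 1) - z (i + 1)) - z (i - 1) =
      (1 / 2 - I * s) * (z (i + 1) - z (i - 1)) := by ring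
  have e2 : z (i + 1) - ((z (i - 1) + z (i + 1)) / 2 + I * s * (z (i - 1) - z (i + 1))) =
      (1 / 2 + I * s) * (z (i + 1) - z (i - 1)) := by ring
  simp only [e1, e2, norm_mul, hs, hs'] at h
  simp only [perim, raise, h, sidesAt, base]
  ring

lemma area_raise (hn : 3 ≤ n) (z : ZMod n → ℂ) (i : ZMod n) (s : ℝ) :
    area (raise z i s) = area z - ear z i + s * base z i ^ 2 / 2 := by
  have h := sum_update_succ hn (fun u v ↦ (conj u * v).im) z i
    ((z (i - 1) + z (i + 1)) / 2 + I * s * (z (i - 1) - z (i + 1)))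
  rw [area, raise, h, area, ear, base, ← normSq_eq_norm_sq, normSq_apply]
  have e : (z (i - 1) + z (i + 1)) / 2 = ((1 / 2 : ℝ) : ℂ) * (z (i - 1) + z (i + 1)) := by
    push_cast; ring
  rw [e]
  simp only [mul_im, mul_re, conj_re, conj_im, add_re, add_im, sub_re, sub_im, I_re, I_im,
    ofReal_re, ofReal_im]
  ring

lemma sidesAt_le_perim (hn : 3 ≤ n) (z : ZMod n → ℂ) (i : ZMod n) : sidesAt z i ≤ perim z := by
  have : Fact (1 < n) := ⟨by lia⟩
  have h1 : i - 1 ≠ i := by simp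
  calc sidesAt z i = ∑ j ∈ {i - 1, i}, ‖z (j + 1) - z j‖ := by
        rw [Finset.sum_pair h1, sub_add_cancel, sidesAt]
    _ ≤ _ := Finset.sum_le_sum_of_subset_of_nonneg (Finset.subset_univ _)
        fun _ _ _ ↦ norm_nonneg _

/-- Making the two sides at a vertex equally long improves an isoperimetric inequality. -/
lemma area_add_gain_le (hn : 3 ≤ n) {M : ℝ} (hM : ∀ z : ZMod n → ℂ, area z ≤ M * perim z ^ 2)
    {z : ZMod n → ℂ} (hz : perim z = 1) (i : ZMod n) :
    area z + √(sidesAt z i ^ 2 - base z i ^ 2) * sideDiff z i ^ 2 / 8 ≤ M := by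
  have hd := abs_sideDiff_le z i
  have hm := base_le_sidesAt z i
  have hL := sidesAt_le_perim hn z i
  have hear := sixteen_mul_ear_sq z i
  obtain hb | hb := (base_nonneg z i).eq_or_lt
  · rw [← hb, abs_nonpos_iff] at hd
    have := hM z
    rw [hz] at this
    simpa [hd] using this
  have hsq : sideDiff z i ^ 2 ≤ base z i ^ 2 := sq_le_sq.2 (by rwa [abs_of_pos hb])
  set b := base z i
  set m := sidesAt z i
  set d := sideDiff z i
  set R := √(m ^ 2 - b ^ 2) with hR
  have hR0 : 0 ≤ R := Real.sqrt_nonneg _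
  have hR2 : R ^ 2 = m ^ 2 - b ^ 2 := Real.sq_sqrt (by nlinarith)
  -- This height gives the new sides total length `m`, so the perimeter does not change.
  have h := hM (raise z i (R / (2 * b)))
  have hroot : √(1 + 4 * (R / (2 * b)) ^ 2) = m / b := by
    rw [Real.sqrt_eq_iff_mul_self_eq (by positivity) (div_nonneg (hb.le.trans hm) hb.le)]
    field_simp
    linarith
  rw [perim_raise hn, area_raise hn, hroot, mul_div_cancel₀ _ hb.ne', hz] at h
  -- By Heron the area is at most `R / 4 * √(b² - d²)`, and `√(b² - d²) ≤ b - d² / (2b)`.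
  have hear2 : ear z i ≤ R / 4 * (b - d ^ 2 / (2 * b)) := by
    have hnn : 0 ≤ b - d ^ 2 / (2 * b) := by
      rw [sub_nonneg, div_le_iff₀ (by positivity)]
      nlinarith
    refine abs_le_of_sq_le_sq' ?_ (by positivity) |>.2
    have : (b - d ^ 2 / (2 * b)) ^ 2 = b ^ 2 - d ^ 2 + (d ^ 2 / (2 * b)) ^ 2 := by
      field_simp
      ring
    rw [mul_pow, this, div_pow, hR2]
    have hpos : 0 ≤ (m ^ 2 - b ^ 2) * (d ^ 2 / (2 * b)) ^ 2 :=
      mul_nonneg (by nlinarith) (by positivity)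
    nlinarith
  -- Uses `b ≤ m ≤ perim z = 1`.
  have hgain : d ^ 2 / 2 ≤ d ^ 2 / (2 * b) := by
    apply div_le_div_of_nonneg_left (sq_nonneg d) (by positivity)
    linarith
  have e : R / (2 * b) * b ^ 2 / 2 = R / 4 * b := by
    field_simp
    ring
  rw [e] at h
  have := mul_le_mul_of_nonneg_left hgain (show 0 ≤ R / 4 by positivity)
  change area z - ear z i + _ ≤ M * (1 - m + m) ^ 2 at h
  nlinarith

/-- Closed polygonal lines maximizing the area for given perimeter are equilateral. -/
lemma sideDiff_eq_zero_of_area_eq (hn : 3 ≤ n) {M : ℝ}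
    (hM : ∀ z : ZMod n → ℂ, area z ≤ M * perim z ^ 2)
    {z : ZMod n → ℂ} (hz : perim z = 1) (hzM : area z = M) (i : ZMod n) : sideDiff z i = 0 := by
  by_contra hne
  have hgain := area_add_gain_le hn hM hz i
  have hd := abs_sideDiff_le z i
  have hm := base_le_sidesAt z i
  have hL := sidesAt_le_perim hn z i
  have hear := sixteen_mul_ear_sq z i
  have hb : 0 < base z i := (abs_pos.2 hne).trans_le hd
  have hraise (s : ℝ) := hM (raise z i s)
  simp only [perim_raise hn, area_raise hn, hz, hzM] at hraise
  have hd2 : 0 < sideDiff z i ^ 2 := by positivity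
  set b := base z i
  set m := sidesAt z i
  set d := sideDiff z i
  -- A maximiser has no gain, so `d ≠ 0` leaves only a flat vertex, with `m = b`.
  have hR : √(m ^ 2 - b ^ 2) = 0 := by
    have := Real.sqrt_nonneg (m ^ 2 - b ^ 2)
    by_contra hR
    have : 0 < √(m ^ 2 - b ^ 2) * d ^ 2 := by positivity
    linarith
  rw [Real.sqrt_eq_zero (by nlinarith)] at hR
  have hmb : m = b := by nlinarith
  have hear0 : ear z i = 0 := by
    rw [hR, zero_mul] at hear
    simpa using hear
  rw [hear0, hmb] at hraise
  have hb1 : b ≤ 1 := by linarith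
  -- Raising a flat vertex by a small `s` gains area `s b² / 2`, linear in `s`, while the perimeter
  -- cost is at most `8 |M| b s²`. This `s` makes `16 |M| s < b`, so the gain wins, contradicting
  -- maximality.
  set s := b / (16 * |M| + 17)
  have hM0 := abs_nonneg M
  have hs0 : 0 < s := by positivity
  have hs1 : s ≤ 1 := by
    rw [div_le_one (by positivity)]
    linarith
  have hs := hraise s
  set r := √(1 + 4 * s ^ 2)
  have hr1 : 1 ≤ r := Real.one_le_sqrt.2 (by nlinarith)
  have hr2 : r ≤ 1 + 2 * s ^ 2 := by
    refine Real.sqrt_le_iff.2 ⟨by positivity, ?_⟩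
    nlinarith [sq_nonneg (s ^ 2)]
  have hX : (1 - b + b * r) ^ 2 - 1 ≤ 8 * b * s ^ 2 := by
    have h1 : 0 ≤ b * (r - 1) := mul_nonneg hb.le (by linarith)
    have h2 : b * (r - 1) ≤ 2 * b * s ^ 2 := by nlinarith
    have h3 : b * (r - 1) ≤ 2 := by nlinarith
    nlinarith
  have hX0 : 0 ≤ (1 - b + b * r) ^ 2 - 1 := by nlinarith [mul_nonneg hb.le (sub_nonneg.2 hr1)]
  have h1 : s * b ^ 2 / 2 ≤ |M| * (8 * b * s ^ 2) := by
    calc s * b ^ 2 / 2 ≤ M * ((1 - b + b * r) ^ 2 - 1) := by linarith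
      _ ≤ |M| * ((1 - b + b * r) ^ 2 - 1) := mul_le_mul_of_nonneg_right (le_abs_self M) hX0
      _ ≤ _ := mul_le_mul_of_nonneg_left hX hM0
  have h2 : s * b * b ≤ s * b * (16 * |M| * s) := by nlinarith
  have h3 : b ≤ 16 * |M| * s := le_of_mul_le_mul_left h2 (by positivity)
  have h4 : s * (16 * |M| + 17) = b := div_mul_cancel₀ _ (by positivity)
  nlinarith

/-! ### Variances and deficit: continuity, compactness and scaling. -/

/-- The variance of the side lengths. -/
noncomputable def sideVar (z : ZMod n → ℂ) : ℝ :=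
  1 / (n : ℝ) * sqSides z - 1 / (n : ℝ) ^ 2 * perim z ^ 2

/-- The variance of the radii. -/
noncomputable def radVar (z : ZMod n → ℂ) : ℝ :=
  1 / (n : ℝ) * ∑ j, ‖centroid z - z j‖ ^ 2 - 1 / (n : ℝ) ^ 2 * (∑ j, ‖centroid z - z j‖) ^ 2

/-- The isoperimetric deficit with respect to the signed area. -/
noncomputable def signedDeficit (z : ZMod n → ℂ) : ℝ :=
  perim z ^ 2 - 4 * n * Real.tan (Real.pi / n) * area z

lemma continuous_perim : Continuous (perim : (ZMod n → ℂ) → ℝ) := by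
  unfold perim; fun_prop

lemma continuous_sqSides : Continuous (sqSides : (ZMod n → ℂ) → ℝ) := by
  unfold sqSides; fun_prop

lemma continuous_area : Continuous (area : (ZMod n → ℂ) → ℝ) := by
  unfold area
  have (j : ZMod n) : Continuous fun z : ZMod n → ℂ ↦ (conj (z j) * z (j + 1)).im :=
    continuous_im.comp ((continuous_conj.comp (continuous_apply _)).mul (continuous_apply _))
  fun_prop

lemma continuous_sideVar : Continuous (sideVar : (ZMod n → ℂ) → ℝ) := by
  have := continuous_perim (n := n)
  have := continuous_sqSides (n := n)
  unfold sideVar; fun_prop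

lemma continuous_radVar : Continuous (radVar : (ZMod n → ℂ) → ℝ) := by
  unfold radVar centroid; fun_prop

lemma continuous_signedDeficit : Continuous (signedDeficit : (ZMod n → ℂ) → ℝ) := by
  have := continuous_perim (n := n)
  have := continuous_area (n := n)
  unfold signedDeficit; fun_prop

lemma norm_side_le_perim (z : ZMod n → ℂ) (j : ZMod n) : ‖z (j + 1) - z j‖ ≤ perim z :=
  Finset.single_le_sum (f := fun j ↦ ‖z (j + 1) - z j‖) (fun _ _ ↦ norm_nonneg _) (mem_univ j)

lemma perim_nonneg (z : ZMod n → ℂ) : 0 ≤ perim z := Finset.sum_nonneg fun _ _ ↦ norm_nonneg _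

lemma dist_zero_le_of_dist_succ_le {X : Type*} [PseudoMetricSpace X] {f : ZMod n → X} {D : ℝ}
    (hf : ∀ j, dist (f (j + 1)) (f j) ≤ D) (j : ZMod n) : dist (f j) (f 0) ≤ n * D := by
  have h (k : ℕ) : dist (f k) (f 0) ≤ k * D := by
    induction k with
    | zero => simp
    | succ k ih =>
      push_cast
      linarith [dist_triangle (f (k + 1)) (f k) (f 0), hf k]
  have hD : 0 ≤ D := dist_nonneg.trans (hf 0)
  have hj := h j.val
  rw [natCast_zmod_val] at hj
  refine hj.trans (mul_le_mul_of_nonneg_right ?_ hD)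
  exact_mod_cast (ZMod.val_lt j).le

/-- Closed polygonal lines of unit length based at the origin. -/
def unitLoops (n : ℕ) [NeZero n] : Set (ZMod n → ℂ) := {z | perim z = 1 ∧ z 0 = 0}

lemma isCompact_unitLoops : IsCompact (unitLoops n) := by
  have hcl : IsClosed (unitLoops n) :=
    (isClosed_eq continuous_perim continuous_const).inter
      (isClosed_eq (continuous_apply 0) continuous_const)
  refine (isCompact_closedBall (0 : ZMod n → ℂ) (n : ℝ)).of_isClosed_subset hcl ?_
  rintro z ⟨hz, hz0⟩
  rw [mem_closedBall_zero_iff, pi_norm_le_iff_of_nonneg (Nat.cast_nonneg n)]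
  intro j
  have := dist_zero_le_of_dist_succ_le (f := z) (D := 1)
    (fun j ↦ by rw [dist_eq_norm, ← hz]; exact norm_side_le_perim z j) j
  simpa [hz0] using this

/-- The image of a polygon under translation and scaling, with a vertex at the origin. -/
noncomputable def rescale (r : ℝ) (z : ZMod n → ℂ) : ZMod n → ℂ := fun j ↦ r * (z j - z 0)

lemma norm_side_rescale {n : ℕ} {r : ℝ} (hr : 0 ≤ r) (z : ZMod n → ℂ) (j : ZMod n) :
    ‖rescale r z (j + 1) - rescale r z j‖ = r * ‖z (j + 1) - z j‖ := by
  rw [rescale, rescale, ← mul_sub, sub_sub_sub_cancel_right, norm_mul, Complex.norm_real, Real.norm_of_nonneg hr]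

lemma perim_rescale {r : ℝ} (hr : 0 ≤ r) (z : ZMod n → ℂ) :
    perim (rescale r z) = r * perim z := by
  simp only [perim, norm_side_rescale hr, Finset.mul_sum]

lemma sqSides_rescale {r : ℝ} (hr : 0 ≤ r) (z : ZMod n → ℂ) :
    sqSides (rescale r z) = r ^ 2 * sqSides z := by
  simp only [sqSides, norm_side_rescale hr, Finset.mul_sum, mul_pow]

lemma area_rescale (r : ℝ) (z : ZMod n → ℂ) : area (rescale r z) = r ^ 2 * area z := by
  have h (j : ZMod n) : (conj (rescale r z j) * rescale r z (j + 1)).im =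
      r ^ 2 * ((conj (z j) * z (j + 1)).im +
        ((conj (z (j + 1)) * z 0).im - (conj (z j) * z 0).im)) := by
    simp only [rescale, mul_im, mul_re, conj_re, conj_im, sub_re, sub_im, ofReal_re, ofReal_im]
    ring
  simp only [area, h]
  rw [← Finset.mul_sum, Finset.sum_add_distrib, Finset.sum_sub_distrib,
    sum_add_one fun j ↦ (conj (z j) * z 0).im]
  ring

lemma centroid_sub_rescale {r : ℝ} (hr : 0 ≤ r) (z : ZMod n → ℂ) (j : ZMod n) :
    ‖centroid (rescale r z) - rescale r z j‖ = r * ‖centroid z - z j‖ := by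
  have hn : (n : ℂ) ≠ 0 := NeZero.ne _
  have : centroid (rescale r z) - rescale r z j = r * (centroid z - z j) := by
    simp only [centroid, rescale, ← Finset.mul_sum, Finset.sum_sub_distrib, Finset.sum_const,
      card_univ, ZMod.card, nsmul_eq_mul]
    field_simp
    ring
  rw [this, norm_mul, Complex.norm_real, Real.norm_of_nonneg hr]

lemma sideVar_rescale {r : ℝ} (hr : 0 ≤ r) (z : ZMod n → ℂ) :
    sideVar (rescale r z) = r ^ 2 * sideVar z := by
  rw [sideVar, sqSides_rescale hr, perim_rescale hr, sideVar]
  ring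

lemma radVar_rescale {r : ℝ} (hr : 0 ≤ r) (z : ZMod n → ℂ) :
    radVar (rescale r z) = r ^ 2 * radVar z := by
  simp only [radVar, centroid_sub_rescale hr, mul_pow, ← Finset.mul_sum]
  ring

lemma signedDeficit_rescale {r : ℝ} (hr : 0 ≤ r) (z : ZMod n → ℂ) :
    signedDeficit (rescale r z) = r ^ 2 * signedDeficit z := by
  rw [signedDeficit, perim_rescale hr, area_rescale, signedDeficit]
  ring

lemma rescale_mem_unitLoops {z : ZMod n → ℂ} (hz : 0 < perim z) :
    rescale (perim z)⁻¹ z ∈ unitLoops n :=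
  ⟨by rw [perim_rescale (inv_nonneg.2 hz.le), inv_mul_cancel₀ hz.ne'], by simp [rescale]⟩

lemma eq_of_perim_eq_zero {z : ZMod n → ℂ} (hz : perim z = 0) (j : ZMod n) : z j = z 0 := by
  have := dist_zero_le_of_dist_succ_le (f := z) (D := 0)
    (fun j ↦ by rw [dist_eq_norm, ← hz]; exact norm_side_le_perim z j) j
  rw [mul_zero] at this
  exact dist_le_zero.1 this

lemma area_eq_zero_of_perim_eq_zero {z : ZMod n → ℂ} (hz : perim z = 0) : area z = 0 := by
  simp only [area, eq_of_perim_eq_zero hz, mul_im, conj_re, conj_im]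
  simp [mul_comm]

/-! ### Variance estimates and the isoperimetric inequality. -/

/-- The mean minimises the sum of squared deviations, so any convenient `a` bounds the variance. -/
lemma card_mul_sum_sq_sub_sq_sum_le {ι : Type*} [Fintype ι] (x : ι → ℝ) (a : ℝ) :
    Fintype.card ι * ∑ i, x i ^ 2 - (∑ i, x i) ^ 2 ≤ Fintype.card ι * ∑ i, (x i - a) ^ 2 := by
  simp only [sub_sq, Finset.sum_add_distrib, Finset.sum_sub_distrib, Finset.sum_const, card_univ,
    nsmul_eq_mul, ← Finset.sum_mul, ← Finset.mul_sum]
  nlinarith [sq_nonneg (∑ i, x i - Fintype.card ι * a)]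

/-- Consecutive side lengths differ by at most `√E`, so all are within `n * √E` of the side at `0`.
-/
lemma sideVar_le_of_sideDiff_sq_le {z : ZMod n → ℂ} {E : ℝ} (hE : ∀ i, sideDiff z i ^ 2 ≤ E) :
    sideVar z ≤ n ^ 2 * E := by
  have hn : (0 : ℝ) < n := by have := NeZero.pos n; exact_mod_cast this
  have hE0 : 0 ≤ E := (sq_nonneg _).trans (hE 0)
  have h (j : ZMod n) : (‖z (j + 1) - z j‖ - ‖z (0 + 1) - z 0‖) ^ 2 ≤ (n * √E) ^ 2 := by
    rw [sq_le_sq, abs_of_nonneg (show 0 ≤ n * √E by positivity), ← Real.dist_eq]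
    refine dist_zero_le_of_dist_succ_le (f := fun j ↦ ‖z (j + 1) - z j‖) (fun i ↦ ?_) j
    have h1 := hE (i + 1)
    rw [sideDiff, add_sub_cancel_right] at h1
    rw [dist_comm, Real.dist_eq]
    exact Real.abs_le_sqrt h1
  have h1 := card_mul_sum_sq_sub_sq_sum_le (fun j ↦ ‖z (j + 1) - z j‖) ‖z (0 + 1) - z 0‖
  have h2 : ∑ j, (‖z (j + 1) - z j‖ - ‖z (0 + 1) - z 0‖) ^ 2 ≤ n * (n * √E) ^ 2 := by
    refine (Finset.sum_le_sum fun j _ ↦ h j).trans_eq ?_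
    simp [ZMod.card]
  rw [ZMod.card] at h1
  change n * sqSides z - perim z ^ 2 ≤ _ at h1
  have h3 := h1.trans (mul_le_mul_of_nonneg_left h2 hn.le)
  rw [mul_pow, Real.sq_sqrt hE0] at h3
  have e : sideVar z = (n * sqSides z - perim z ^ 2) / n ^ 2 := by
    rw [sideVar]; field_simp
  rw [e, div_le_iff₀ (by positivity)]
  linarith

/-- The radii are compared with `‖b‖`, the common radius of the regular polygon `b * stdAddChar j`.
-/
lemma radVar_le (z : ZMod n → ℂ) (b : ℂ) :
    radVar z ≤ 1 / n * ∑ j, ‖z j - centroid z - b * stdAddChar j‖ ^ 2 := by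
  have hn : (0 : ℝ) < n := by have := NeZero.pos n; exact_mod_cast this
  have h1 := card_mul_sum_sq_sub_sq_sum_le (fun j ↦ ‖centroid z - z j‖) ‖b‖
  have h2 (j : ZMod n) : (‖centroid z - z j‖ - ‖b‖) ^ 2 ≤
      ‖z j - centroid z - b * stdAddChar j‖ ^ 2 := by
    rw [sq_le_sq, abs_norm, norm_sub_rev]
    have := abs_norm_sub_norm_le (z j - centroid z) (b * stdAddChar j)
    rwa [norm_mul, AddChar.norm_apply, mul_one] at this
  have h3 := Finset.sum_le_sum fun j (_ : j ∈ univ) ↦ h2 j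
  rw [ZMod.card] at h1
  have h4 := h1.trans (mul_le_mul_of_nonneg_left h3 hn.le)
  have e : radVar z = (n * ∑ j, ‖centroid z - z j‖ ^ 2 - (∑ j, ‖centroid z - z j‖) ^ 2) / n ^ 2 := by
    rw [radVar]; field_simp
  rw [e, div_le_iff₀ (by positivity)]
  refine h4.trans_eq ?_
  field_simp

lemma mul_sqSides_sub_area (z : ZMod n → ℂ) :
    n * (sqSides z - 4 * Real.tan (Real.pi / n) * area z) = n ^ 2 * sideVar z + signedDeficit z := by
  have hn : (n : ℝ) ≠ 0 := NeZero.ne _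
  rw [sideVar, signedDeficit]
  field_simp
  ring

/-- The isoperimetric inequality for polygons. -/
theorem signedDeficit_nonneg (hn : 3 ≤ n) (z : ZMod n → ℂ) : 0 ≤ signedDeficit z := by
  obtain hz | hz := (perim_nonneg z).eq_or_lt
  · rw [signedDeficit, area_eq_zero_of_perim_eq_zero hz.symm, ← hz]
    simp
  obtain ⟨w, ⟨hw, -⟩, hmax⟩ := isCompact_unitLoops.exists_isMaxOn ⟨_, rescale_mem_unitLoops hz⟩
    continuous_area.continuousOn
  -- Maximality on unit loops extends to all polygons by scaling.
  have hM (y : ZMod n → ℂ) : area y ≤ area w * perim y ^ 2 := by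
    obtain hy | hy := (perim_nonneg y).eq_or_lt
    · simp [area_eq_zero_of_perim_eq_zero hy.symm, ← hy]
    have := hmax (rescale_mem_unitLoops hy)
    simp only [Set.mem_ofPred_eq, area_rescale, inv_pow] at this
    rwa [inv_mul_le_iff₀ (by positivity), mul_comm] at this
  have hside : sideVar w ≤ 0 := by
    have := sideVar_le_of_sideDiff_sq_le (z := w) (E := 0) fun i ↦ by
      rw [sideDiff_eq_zero_of_area_eq hn hM hw rfl i]; simp
    simpa using this
  obtain ⟨c, hc, hwirt⟩ := exists_wirtinger (n := n) hn
  obtain ⟨b, hb⟩ := hwirt w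
  have h0 : 0 ≤ sqSides w - 4 * Real.tan (Real.pi / n) * area w := le_trans (by positivity) hb
  have h1 : 0 ≤ signedDeficit w := by
    have h2 := mul_sqSides_sub_area w
    have h3 : 0 ≤ (n : ℝ) * (sqSides w - 4 * Real.tan (Real.pi / n) * area w) := by positivity
    have h4 : (n : ℝ) ^ 2 * sideVar w ≤ 0 := mul_nonpos_of_nonneg_of_nonpos (by positivity) hside
    linarith
  rw [signedDeficit, hw] at h1
  have ht := tan_pi_div_pos hn
  have h5 := mul_le_mul_of_nonneg_left (hM z)
    (show 0 ≤ 4 * n * Real.tan (Real.pi / n) by positivity)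
  have h6 : 0 ≤ perim z ^ 2 * (1 ^ 2 - 4 * n * Real.tan (Real.pi / n) * area w) := by positivity
  rw [signedDeficit]
  linarith

lemma area_le (hn : 3 ≤ n) (z : ZMod n → ℂ) :
    area z ≤ 1 / (4 * n * Real.tan (Real.pi / n)) * perim z ^ 2 := by
  have := signedDeficit_nonneg hn z
  have ht := tan_pi_div_pos hn
  rw [signedDeficit] at this
  rw [one_div, inv_mul_eq_div, le_div_iff₀ (by positivity)]
  linarith

/-! ### The equality case and stability for the signed area. -/

lemma two_add_two_mul_re_stdAddChar (k : ZMod n) :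
    ‖(stdAddChar k + 1 : ℂ)‖ ^ 2 = 2 + 2 * (stdAddChar k).re := by
  rw [← normSq_eq_norm_sq, normSq_add, normSq_eq_norm_sq, AddChar.norm_apply]
  simp
  ring

lemma re_stdAddChar_one_lt_one (hn : 3 ≤ n) : (stdAddChar (1 : ZMod n)).re < 1 := by
  rw [(stdAddChar_re_im 1).1, val_one_of_three_le hn, Real.cos_two_mul, Real.cos_sq']
  have := sin_pi_div_pos hn
  simp only [Nat.cast_one, mul_one]
  nlinarith

/-- Equality in the isoperimetric inequality: the polygon is regular, so that no angle is flat. -/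
lemma sidesAt_sq_sub_base_sq_of_signedDeficit_eq_zero (hn : 3 ≤ n) {z : ZMod n → ℂ}
    (hz : perim z = 1) (h0 : signedDeficit z = 0) (i : ZMod n) :
    sidesAt z i ^ 2 - base z i ^ 2 = 2 * (1 - (stdAddChar (1 : ZMod n)).re) / n ^ 2 := by
  have hn0 : (n : ℝ) ≠ 0 := NeZero.ne _
  have ht := tan_pi_div_pos hn
  have hdiff (i : ZMod n) : sideDiff z i = 0 := by
    refine sideDiff_eq_zero_of_area_eq hn (area_le hn) hz ?_ i
    rw [signedDeficit, hz] at h0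
    rw [eq_div_iff (by positivity)]
    linarith
  have hside : sideVar z ≤ 0 := by
    have := sideVar_le_of_sideDiff_sq_le (z := z) (E := 0) fun i ↦ by simp [hdiff]
    simpa using this
  obtain ⟨c, hc, hwirt⟩ := exists_wirtinger (n := n) hn
  obtain ⟨b, hb⟩ := hwirt z
  -- With equal sides and zero deficit the Wirtinger defect vanishes, so `z` is exactly a regular
  -- polygon.
  have h1 : ∑ j, ‖z j - centroid z - b * stdAddChar j‖ ^ 2 = 0 := by
    refine le_antisymm ?_ (by positivity)
    have h2 := mul_sqSides_sub_area z
    have h4 : (n : ℝ) ^ 2 * sideVar z ≤ 0 := mul_nonpos_of_nonneg_of_nonpos (by positivity) hside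
    have h5 := mul_le_mul_of_nonneg_left hb (Nat.cast_nonneg (α := ℝ) n)
    rw [h2, h0, ← mul_assoc] at h5
    have hnc : 0 < (n : ℝ) * c := by positivity
    by_contra! h6
    have := mul_pos hnc h6
    linarith
  have hreg (j : ZMod n) : z j = centroid z + b * stdAddChar j := by
    have := (Finset.sum_eq_zero_iff_of_nonneg fun _ _ ↦ by positivity).1 h1 j (mem_univ j)
    simp only [ne_eq, OfNat.ofNat_ne_zero, not_false_eq_true, pow_eq_zero_iff, norm_eq_zero] at this
    linear_combination this
  have hlen (j : ZMod n) : ‖z (j + 1) - z j‖ = ‖b‖ * ‖(stdAddChar (1 : ZMod n) - 1 : ℂ)‖ := by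
    have : z (j + 1) - z j = b * stdAddChar j * (stdAddChar (1 : ZMod n) - 1) := by
      rw [hreg (j + 1), hreg j, AddChar.map_add_eq_mul]; ring
    rw [this, norm_mul, norm_mul, AddChar.norm_apply, mul_one]
  have hper : n * (‖b‖ * ‖(stdAddChar (1 : ZMod n) - 1 : ℂ)‖) = 1 := by
    rw [← hz, perim]
    simp [hlen, ZMod.card]
  have hlen' : ‖z i - z (i - 1)‖ = ‖b‖ * ‖(stdAddChar (1 : ZMod n) - 1 : ℂ)‖ := by
    simpa using hlen (i - 1)
  have hbase : base z i = ‖b‖ * ‖(stdAddChar (1 : ZMod n) - 1 : ℂ)‖ *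
      ‖(stdAddChar (1 : ZMod n) + 1 : ℂ)‖ := by
    have : z (i + 1) - z (i - 1) = b * stdAddChar (i - 1) *
        ((stdAddChar (1 : ZMod n) - 1) * (stdAddChar (1 : ZMod n) + 1)) := by
      have e : i + 1 = (i - 1) + 1 + 1 := by ring
      rw [e, hreg (i - 1 + 1 + 1), hreg (i - 1), AddChar.map_add_eq_mul, AddChar.map_add_eq_mul]
      ring
    rw [base, this, norm_mul, norm_mul, norm_mul, AddChar.norm_apply, mul_one, mul_assoc]
  rw [sidesAt, hbase, hlen', hlen i, mul_pow _ ‖(stdAddChar (1 : ZMod n) + 1 : ℂ)‖,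
    two_add_two_mul_re_stdAddChar, eq_div_iff (by positivity)]
  set l := ‖b‖ * ‖(stdAddChar (1 : ZMod n) - 1 : ℂ)‖
  calc _ = (n * l) ^ 2 * (2 * (1 - (stdAddChar (1 : ZMod n)).re)) := by ring
    _ = _ := by rw [hper]; ring

/-- Away from flat angles, the variances are controlled by the deficit. -/
lemma exists_variance_le_of_le (hn : 3 ≤ n) {η : ℝ} (hη : 0 < η) : ∃ C : ℝ, 0 < C ∧
    ∀ z : ZMod n → ℂ, perim z = 1 → (∀ i, η ≤ sidesAt z i ^ 2 - base z i ^ 2) →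
      sideVar z + radVar z ≤ C * signedDeficit z := by
  have hn0 : (0 : ℝ) < n := by positivity
  have ht := tan_pi_div_pos hn
  obtain ⟨c, hc, hwirt⟩ := exists_wirtinger (n := n) hn
  have hs : 0 < √η := Real.sqrt_pos.2 hη
  set Q := 8 / (√η * (4 * n * Real.tan (Real.pi / n))) with hQ
  have hQ0 : 0 < Q := by positivity
  refine ⟨n ^ 2 * Q + 1 / (n ^ 2 * c) * (n ^ 2 * (n ^ 2 * Q) + 1), by positivity,
    fun z hz hflat ↦ ?_⟩
  -- The area gain cannot exceed the room left by the sharp isoperimetric constant, and that room is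
  -- a multiple of the deficit.
  have hdiff (i : ZMod n) : sideDiff z i ^ 2 ≤ Q * signedDeficit z := by
    have h1 := area_add_gain_le hn (area_le hn) hz i
    have h2 : √η * sideDiff z i ^ 2 ≤ √(sidesAt z i ^ 2 - base z i ^ 2) * sideDiff z i ^ 2 :=
      mul_le_mul_of_nonneg_right (Real.sqrt_le_sqrt (hflat i)) (sq_nonneg _)
    have h3 : area z + √η * sideDiff z i ^ 2 / 8 ≤ 1 / (4 * n * Real.tan (Real.pi / n)) := by
      linarith
    rw [le_div_iff₀ (by positivity)] at h3
    rw [hQ, div_mul_eq_mul_div, le_div_iff₀ (by positivity), signedDeficit, hz]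
    linarith
  have hside := sideVar_le_of_sideDiff_sq_le hdiff
  have hrad : radVar z ≤ 1 / (n ^ 2 * c) * (n ^ 2 * sideVar z + signedDeficit z) := by
    obtain ⟨b, hb⟩ := hwirt z
    have h1 := radVar_le z b
    rw [← mul_sqSides_sub_area]
    refine h1.trans ?_
    rw [one_div_mul_eq_div, one_div_mul_eq_div, div_le_div_iff₀ hn0 (by positivity)]
    have := mul_le_mul_of_nonneg_left hb (show 0 ≤ (n : ℝ) ^ 2 by positivity)
    linarith
  have h4 : 1 / (n ^ 2 * c) * (n ^ 2 * sideVar z + signedDeficit z) ≤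
      1 / (n ^ 2 * c) * (n ^ 2 * (n ^ 2 * (Q * signedDeficit z)) + signedDeficit z) := by
    gcongr
  linarith

/-- Stability of the isoperimetric inequality for polygons with respect to the signed area. -/
theorem exists_variance_le (hn : 3 ≤ n) : ∃ C : ℝ, 0 < C ∧
    ∀ z : ZMod n → ℂ, sideVar z + radVar z ≤ C * signedDeficit z := by
  have hω := re_stdAddChar_one_lt_one hn
  have hn0 : (0 : ℝ) < n := by positivity
  -- Half the value of `sidesAt² - base²` at equality, so `K` below contains no polygon of zero
  -- deficit.
  set η : ℝ := (1 - (stdAddChar (1 : ZMod n)).re) / n ^ 2 with hη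
  have hη0 : 0 < η := div_pos (by linarith) (by positivity)
  obtain ⟨C₁, hC₁, hgood⟩ := exists_variance_le_of_le hn hη0
  set K : Set (ZMod n → ℂ) := unitLoops n ∩ ⋃ i, {z | sidesAt z i ^ 2 - base z i ^ 2 ≤ η}
  have hK : IsCompact K := by
    refine isCompact_unitLoops.inter_right (isClosed_iUnion_of_finite fun i ↦ ?_)
    refine isClosed_le ?_ continuous_const
    unfold sidesAt base
    fun_prop
  have hpos (z) (hz : z ∈ K) : 0 < signedDeficit z := by
    refine (signedDeficit_nonneg hn z).lt_of_ne' fun h ↦ ?_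
    obtain ⟨i, hi⟩ := Set.mem_iUnion.1 hz.2
    rw [Set.mem_ofPred_eq, sidesAt_sq_sub_base_sq_of_signedDeficit_eq_zero hn hz.1.1 h i,
      mul_div_assoc, ← hη] at hi
    linarith
  obtain ⟨C₂, hC₂⟩ := hK.bddAbove_image (f := fun z ↦ (sideVar z + radVar z) / signedDeficit z)
    ((continuous_sideVar.add continuous_radVar).continuousOn.div
      continuous_signedDeficit.continuousOn fun z hz ↦ (hpos z hz).ne')
  refine ⟨max C₁ C₂, lt_max_of_lt_left hC₁, fun z ↦ ?_⟩
  have hunit (w) (hw : w ∈ unitLoops n) :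
      sideVar w + radVar w ≤ max C₁ C₂ * signedDeficit w := by
    have hδ := signedDeficit_nonneg hn w
    by_cases hwK : w ∈ K
    · have := hC₂ (Set.mem_image_of_mem _ hwK)
      rw [div_le_iff₀ (hpos w hwK)] at this
      exact this.trans (mul_le_mul_of_nonneg_right (le_max_right _ _) hδ)
    · refine (hgood w hw.1 fun i ↦ ?_).trans
        (mul_le_mul_of_nonneg_right (le_max_left _ _) hδ)
      by_contra! hi
      exact hwK ⟨hw, Set.mem_iUnion.2 ⟨i, hi.le⟩⟩
  obtain hz | hz := (perim_nonneg z).eq_or_lt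
  · have hconst := eq_of_perim_eq_zero hz.symm
    have hc : centroid z = z 0 := by
      simp only [centroid, hconst]
      simp [ZMod.card, NeZero.ne n]
    have h1 : sideVar z = 0 := by simp [sideVar, sqSides, ← hz, hconst]
    have h2 : radVar z = 0 := by simp [radVar, hc, hconst]
    have h3 : signedDeficit z = 0 := by
      simp [signedDeficit, ← hz, area_eq_zero_of_perim_eq_zero hz.symm]
    simp [h1, h2, h3]
  · have h := hunit _ (rescale_mem_unitLoops hz)
    have hr := (inv_pos.2 hz).le
    rw [sideVar_rescale hr, radVar_rescale hr, signedDeficit_rescale hr, ← mul_add,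
      mul_left_comm] at h
    exact le_of_mul_le_mul_left h (by positivity)

end ComplexPolygon

namespace PlanePolygon

/-! ### Area of a convex polygon by fan triangulation. -/

lemma volume_corner_le {D : ℝ} (hD : 0 ≤ D) :
    volume {y : Plane | 0 ≤ y 0 ∧ 0 ≤ y 1 ∧ y 0 + y 1 ≤ D} ≤ ENNReal.ofReal (D ^ 2 / 2) := by
  set T : Set (ℝ × ℝ) := {p | 0 ≤ p.1 ∧ 0 ≤ p.2 ∧ p.1 + p.2 ≤ D} with hT
  have hTm : MeasurableSet T := by
    have : IsClosed T := (isClosed_le continuous_const continuous_fst).inter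
      ((isClosed_le continuous_const continuous_snd).inter
        (isClosed_le (continuous_fst.add continuous_snd) continuous_const))
    exact this.measurableSet
  have hmp := (volume_preserving_finTwoArrow ℝ).comp (PiLp.volume_preserving_ofLp (Fin 2))
  have hpre : {y : Plane | 0 ≤ y 0 ∧ 0 ≤ y 1 ∧ y 0 + y 1 ≤ D} =
      (MeasurableEquiv.finTwoArrow ∘ (WithLp.ofLp : Plane → Fin 2 → ℝ)) ⁻¹' T := rfl
  rw [hpre, hmp.measure_preimage hTm.nullMeasurableSet, Measure.volume_eq_prod,
    Measure.prod_apply hTm]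
  have hfib (x : ℝ) : volume (Prod.mk x ⁻¹' T) ≤
      (Set.Icc 0 D).indicator (fun x ↦ ENNReal.ofReal (D - x)) x := by
    by_cases hx : x ∈ Set.Icc 0 D
    · rw [Set.indicator_of_mem hx]
      calc volume (Prod.mk x ⁻¹' T) ≤ volume (Set.Icc 0 (D - x)) :=
            measure_mono fun y hy ↦ ⟨hy.2.1, by linarith [hy.2.2]⟩
        _ = _ := by rw [Real.volume_Icc, sub_zero]
    · have : Prod.mk x ⁻¹' T = ∅ := by
        ext y
        simp only [hT, Set.mem_preimage, Set.mem_ofPred_eq, Set.mem_empty_iff_false, iff_false]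
        rintro ⟨h1, h2, h3⟩
        exact hx ⟨h1, by linarith⟩
      simp [this]
  refine (lintegral_mono hfib).trans ?_
  rw [lintegral_indicator measurableSet_Icc, ← ofReal_integral_eq_lintegral_ofReal]
  · rw [integral_Icc_eq_integral_Ioc, ← intervalIntegral.integral_of_le hD]
    apply ENNReal.ofReal_le_ofReal
    rw [intervalIntegral.integral_sub (by simp) intervalIntegral.intervalIntegrable_id,
      intervalIntegral.integral_const, integral_id]
    apply le_of_eq
    rw [smul_eq_mul]
    ring
  · exact (continuous_const.sub continuous_id).integrableOn_Icc
  · filter_upwards [ae_restrict_mem measurableSet_Icc] with x hx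
    simpa using hx.2

/-- The triangle with vertices `0`, `u` and `v` when `0 < cross u v`. -/
def fan (u v : Plane) : Set Plane :=
  {y | 0 ≤ cross u y ∧ 0 ≤ cross y v ∧ cross u y + cross y v ≤ cross u v}

lemma volume_cross_eq_zero {u : Plane} (hu : u ≠ 0) : volume {y : Plane | cross u y = 0} = 0 := by
  let S : Submodule ℝ Plane :=
    { carrier := {y | cross u y = 0}
      add_mem' := fun {a b} ha hb ↦ by
        simp only [Set.mem_ofPred_eq, cross, PiLp.add_apply] at *
        linarith
      zero_mem' := by simp [cross]
      smul_mem' := fun c y hy ↦ by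
        simp only [Set.mem_ofPred_eq, cross, PiLp.smul_apply, smul_eq_mul] at *
        linear_combination c * hy }
  refine Measure.addHaar_submodule volume S fun h ↦ hu ?_
  have h1 : !₂[1, 0] ∈ S := h ▸ Submodule.mem_top
  have h2 : !₂[0, 1] ∈ S := h ▸ Submodule.mem_top
  change cross _ _ = 0 at h1 h2
  ext i
  fin_cases i
  · simpa [cross] using h2
  · simpa [cross] using h1

/-- The map `y ↦ (cross u y, cross y v)` has determinant `-cross u v` and pulls the standard corner
triangle back to the fan. If `cross u v = 0`, the fan lies on a line, since `u` or `v` is nonzero.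
-/
lemma volume_fan_le {u v : Plane} (huv : u ≠ 0 ∨ v ≠ 0) (h : 0 ≤ cross u v) :
    volume (fan u v) ≤ ENNReal.ofReal (cross u v / 2) := by
  obtain h0 | hpos := h.eq_or_lt
  · have hzero : volume (fan u v) = 0 := by
      obtain hu | hv := huv
      · refine measure_mono_null (fun y hy ↦ ?_) (volume_cross_eq_zero hu)
        obtain ⟨h1, h2, h3⟩ := hy
        rw [Set.mem_ofPred_eq]
        linarith
      · refine measure_mono_null (fun y hy ↦ ?_) (volume_cross_eq_zero hv)
        obtain ⟨h1, h2, h3⟩ := hy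
        rw [Set.mem_ofPred_eq]
        have : cross v y = - cross y v := by simp only [cross]; ring
        linarith
    rw [hzero]
    exact zero_le
  · let M : Matrix (Fin 2) (Fin 2) ℝ := !![-u 1, u 0; v 1, -v 0]
    let f : Plane →ₗ[ℝ] Plane := Matrix.toLpLin 2 2 M
    have hdet : LinearMap.det f = -cross u v := by
      have : LinearMap.det f = M.det := by
        simp [f, Matrix.toLpLin_eq_toLin, LinearMap.det_toLin]
      rw [this]
      simp [M, Matrix.det_fin_two_of, cross]
    have hf0 (y : Plane) : f y 0 = cross u y := by
      simp [f, M, cross, Matrix.toLpLin_apply, dotProduct, Fin.sum_univ_two]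
      ring
    have hf1 (y : Plane) : f y 1 = cross y v := by
      simp [f, M, cross, Matrix.toLpLin_apply, dotProduct, Fin.sum_univ_two]
      ring
    have hpre : fan u v = f ⁻¹' {y : Plane | 0 ≤ y 0 ∧ 0 ≤ y 1 ∧ y 0 + y 1 ≤ cross u v} := by
      ext y
      simp only [fan, Set.mem_preimage, Set.mem_ofPred_eq, hf0, hf1]
    rw [hpre, Measure.addHaar_preimage_linearMap volume (by rw [hdet]; simpa using hpos.ne'), hdet]
    refine (mul_le_mul_right (volume_corner_le h) _).trans_eq ?_
    rw [← ENNReal.ofReal_mul (abs_nonneg _), abs_inv, abs_neg, abs_of_pos hpos]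
    congr 1
    field_simp

/-- Turns the half-plane condition for the side `ab` into the third inequality defining the triangle
with apex `c`. -/
lemma cross_sub_sub (a b c x : Plane) : cross (b - a) (x - a) =
    cross (a - c) (b - c) - cross (a - c) (x - c) - cross (x - c) (b - c) := by
  simp only [cross, PiLp.sub_apply]
  ring

lemma convex_halfPlane (ε : ℝ) (u p : Plane) : Convex ℝ {x : Plane | 0 ≤ ε * cross u (x - p)} := by
  intro x hx y hy a b ha hb hab
  simp only [Set.mem_ofPred_eq] at *
  have e : cross u (a • x + b • y - p) = a * cross u (x - p) + b * cross u (y - p) := by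
    obtain rfl : b = 1 - a := by linarith
    simp only [cross, PiLp.sub_apply, PiLp.add_apply, PiLp.smul_apply, smul_eq_mul]
    ring
  rw [e]
  nlinarith [mul_nonneg ha hx, mul_nonneg hb hy]

open Fin.CommRing in
/-- The fan triangulation bounds the area of a convex polygon by the shoelace formula. -/
lemma volume_convexHull_le {m : ℕ} (hm : 1 ≤ m) {ε : ℝ} (hε : ε = 1 ∨ ε = -1) {P : Fin (m + 1) → Plane}
    (hinj : Function.Injective P)
    (hP : ∀ i j, 0 ≤ ε * cross (P (i + 1) - P i) (P j - P i)) :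
    volume.real (convexHull ℝ (Set.range P)) ≤
      ∑ i, ε * cross (P i - P 0) (P (i + 1) - P 0) / 2 := by
  have hhalf (i) (x) (hx : x ∈ convexHull ℝ (Set.range P)) :
      0 ≤ ε * cross (P (i + 1) - P i) (x - P i) := by
    have := convexHull_min (s := Set.range P) (t := {x | 0 ≤ ε * cross (P (i + 1) - P i) (x - P i)})
      (by rintro _ ⟨j, rfl⟩; exact hP i j) (convex_halfPlane _ _ _)
    exact this hx
  have hterm (i) : 0 ≤ ε * cross (P i - P 0) (P (i + 1) - P 0) := by
    have h := hP i 0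
    rw [cross_sub_sub _ _ (P 0)] at h
    simpa [cross] using h
  set T : Fin (m + 1) → Set Plane := fun i ↦
    {x | 0 ≤ ε * cross (P i - P 0) (x - P 0) ∧ 0 ≤ ε * cross (x - P 0) (P (i + 1) - P 0) ∧
      ε * cross (P i - P 0) (x - P 0) + ε * cross (x - P 0) (P (i + 1) - P 0) ≤
        ε * cross (P i - P 0) (P (i + 1) - P 0)} with hT
  -- The index `0` is left out: its triangle is degenerate, and its first edge vector `P 0 - P 0` is
  -- zero.
  have hcover : convexHull ℝ (Set.range P) ⊆ ⋃ i ∈ Finset.univ.filter (· ≠ (0 : Fin (m + 1))), T i := by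
    intro x hx
    -- A discrete intermediate value argument: seen from `P 0`, the signed position of `x` is
    -- nonnegative at `P 1` and zero at `P (m + 1) = P 0`. Without a sign change it would stay
    -- positive up to the end.
    obtain ⟨k, hk1, hkm, hk, hk'⟩ : ∃ k : ℕ, 1 ≤ k ∧ k ≤ m ∧
        0 ≤ ε * cross (P k - P 0) (x - P 0) ∧
        ε * cross (P ((k : Fin (m + 1)) + 1) - P 0) (x - P 0) ≤ 0 := by
      by_contra! hcon
      have h (k : ℕ) (hk : k ≤ m) :
          0 ≤ ε * cross (P ((k : Fin (m + 1)) + 1) - P 0) (x - P 0) ∧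
          (1 ≤ k → 0 < ε * cross (P ((k : Fin (m + 1)) + 1) - P 0) (x - P 0)) := by
        induction k with
        | zero => simpa using hhalf 0 x hx
        | succ k ih =>
          have := hcon (k + 1) (by lia) hk (by push_cast; exact (ih (by lia)).1)
          exact ⟨this.le, fun _ ↦ this⟩
      have hlast : ((m : Fin (m + 1)) + 1) = 0 := by
        rw [Fin.natCast_eq_last, Fin.last_add_one]
      have := (h m le_rfl).2 hm
      rw [hlast] at this
      simp [cross] at this
    simp only [Set.mem_iUnion]
    refine ⟨k, ?_, hk, ?_, ?_⟩
    · simp only [Finset.mem_filter, Finset.mem_univ, true_and, ne_eq, Fin.natCast_eq_zero]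
      exact Nat.not_dvd_of_pos_of_lt hk1 (by lia)
    · have : cross (x - P 0) (P ((k : Fin (m + 1)) + 1) - P 0) =
          - cross (P ((k : Fin (m + 1)) + 1) - P 0) (x - P 0) := by simp only [cross]; ring
      rw [this]
      linarith
    · have := hhalf k x hx
      rw [cross_sub_sub _ _ (P 0)] at this
      linarith
  have hvol (i : Fin (m + 1)) (hi : i ≠ 0) :
      volume (T i) ≤ ENNReal.ofReal (ε * cross (P i - P 0) (P (i + 1) - P 0) / 2) := by
    have hne : P i - P 0 ≠ 0 := sub_ne_zero.2 (hinj.ne hi)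
    have hanti (u v : Plane) : -cross u v = cross v u := by simp only [cross]; ring
    have hi0 := hterm i
    obtain rfl | rfl := hε
    · have : T i = (fun x ↦ x + -P 0) ⁻¹' fan (P i - P 0) (P (i + 1) - P 0) := by
        simp only [hT, one_mul, sub_eq_add_neg]; rfl
      rw [this, measure_preimage_add_right, one_mul]
      exact volume_fan_le (.inl hne) (by simpa using hi0)
    · have : T i = (fun x ↦ x + -P 0) ⁻¹' fan (P (i + 1) - P 0) (P i - P 0) := by
        ext x
        simp only [hT, neg_one_mul, hanti, fan, Set.mem_preimage, Set.mem_ofPred_eq, ← sub_eq_add_neg]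
        rw [add_comm (cross _ (P i - P 0))]
        tauto
      rw [this, measure_preimage_add_right, neg_one_mul, hanti]
      exact volume_fan_le (.inr hne) (by simpa [hanti] using hi0)
  have hsum : volume (convexHull ℝ (Set.range P)) ≤
      ENNReal.ofReal (∑ i, ε * cross (P i - P 0) (P (i + 1) - P 0) / 2) := by
    calc _ ≤ volume (⋃ i ∈ Finset.univ.filter (· ≠ (0 : Fin (m + 1))), T i) := measure_mono hcover
      _ ≤ ∑ i ∈ Finset.univ.filter (· ≠ (0 : Fin (m + 1))), volume (T i) :=
        measure_biUnion_finset_le _ _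
      _ ≤ ∑ i ∈ Finset.univ.filter (· ≠ (0 : Fin (m + 1))),
          ENNReal.ofReal (ε * cross (P i - P 0) (P (i + 1) - P 0) / 2) :=
        Finset.sum_le_sum fun i hi ↦ hvol i (Finset.mem_filter.1 hi).2
      _ ≤ ∑ i, ENNReal.ofReal (ε * cross (P i - P 0) (P (i + 1) - P 0) / 2) :=
        Finset.sum_le_sum_of_subset (Finset.filter_subset _ _)
      _ = _ := (ENNReal.ofReal_sum_of_nonneg fun i _ ↦ div_nonneg (hterm i) two_pos.le).symm
  exact ENNReal.toReal_le_of_le_ofReal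
    (Finset.sum_nonneg fun i _ ↦ div_nonneg (hterm i) two_pos.le) hsum

/-! ### Transfer from the plane to `ℂ`. -/

/-- The identification of the plane with `ℂ`, composed with a reflection if `ε = -1`. -/
noncomputable def toComplex (ε : ℝ) (p : Plane) : ℂ := ⟨p 0, ε * p 1⟩

lemma norm_toComplex_sub {ε : ℝ} (hε : ε ^ 2 = 1) (p q : Plane) :
    ‖toComplex ε p - toComplex ε q‖ = dist p q := by
  rw [EuclideanSpace.dist_eq, Complex.norm_def, Complex.normSq_apply, Fin.sum_univ_two,
    Real.dist_eq, Real.dist_eq, sq_abs, sq_abs]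
  simp only [toComplex, Complex.sub_re, Complex.sub_im]
  congr 1
  linear_combination (p 1 - q 1) ^ 2 * hε

/-- The factors `(1 : ℝ)` match the summands of the area of `rescale 1 z`, the polygon translated so
that vertex `0` is the origin. -/
lemma im_conj_mul_toComplex_sub (ε : ℝ) (p q r : Plane) :
    (starRingEnd ℂ ((1 : ℝ) * (toComplex ε p - toComplex ε r)) *
      ((1 : ℝ) * (toComplex ε q - toComplex ε r))).im = ε * cross (p - r) (q - r) := by
  simp only [toComplex, cross, Complex.mul_im, Complex.mul_re, Complex.conj_re, Complex.conj_im,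
    Complex.sub_re, Complex.sub_im, Complex.ofReal_re, Complex.ofReal_im, PiLp.sub_apply]
  ring

lemma toComplex_center {m : ℕ} (ε : ℝ) (P : Polygon Plane (m + 1)) :
    toComplex ε (center P) =
      ComplexPolygon.centroid (n := m + 1) fun j : Fin (m + 1) ↦ toComplex ε (P j) := by
  have h : (((m + 1 : ℕ) : ℂ))⁻¹ = (((m + 1 : ℕ) : ℝ)⁻¹ : ℝ) := by push_cast; rfl
  change _ = ((m + 1 : ℕ) : ℂ)⁻¹ * ∑ j : Fin (m + 1), toComplex ε (P j)
  rw [h]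
  apply Complex.ext
  · rw [Complex.re_ofReal_mul, Complex.re_sum]
    simp [toComplex, center]
  · rw [Complex.im_ofReal_mul, Complex.im_sum]
    simp [toComplex, center, Finset.mul_sum, mul_left_comm]

/-- The sign `ε` treats both orientations at once: for clockwise polygons, `toComplex` reflects,
which makes the shoelace area nonnegative. -/
theorem exists_signed_variance_le {n : ℕ} (hn : 3 ≤ n) : ∃ C : ℝ, 0 < C ∧
    ∀ (P : Polygon Plane n), Function.Injective P.vertices → ∀ ε : ℝ, ε = 1 ∨ ε = -1 →
      (∀ i j : Fin n, 0 ≤ ε * cross (P (finRotate n i) - P i) (P j - P i)) →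
      sideVariance P + radiusVariance P ≤ C * deficit P := by
  obtain ⟨m, rfl⟩ : ∃ m, n = m + 1 := ⟨n - 1, by lia⟩
  obtain ⟨C, hC, h⟩ := ComplexPolygon.exists_variance_le hn
  refine ⟨C, hC, fun P hinj ε hε hP ↦ ?_⟩
  have hε2 : ε ^ 2 = 1 := by obtain rfl | rfl := hε <;> norm_num
  simp only [finRotate_apply] at hP
  -- `ZMod (m + 1)` is `Fin (m + 1)` by definition, so the sums below agree by `rfl`.
  let z : ZMod (m + 1) → ℂ := fun j : Fin (m + 1) ↦ toComplex ε (P j)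
  have hside (j : Fin (m + 1)) : sideLength P j =
      ‖toComplex ε (P (j + 1)) - toComplex ε (P j)‖ := by
    rw [sideLength, finRotate_apply, dist_comm]
    exact (norm_toComplex_sub hε2 _ _).symm
  have hradius (j : Fin (m + 1)) : radius P j = ‖ComplexPolygon.centroid z - z j‖ := by
    rw [radius, ← norm_toComplex_sub hε2, toComplex_center]
  have hperim : perimeter P = ComplexPolygon.perim z := by
    simp only [perimeter, hside]; rfl
  have hsides : sideVariance P = ComplexPolygon.sideVar z := by
    simp only [sideVariance, ComplexPolygon.sideVar, hperim, sumSqSides, hside]; rfl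
  have hradii : radiusVariance P = ComplexPolygon.radVar z := by
    simp only [radiusVariance, hradius]; rfl
  have harea : convexArea P ≤ ComplexPolygon.area z := by
    refine (volume_convexHull_le (by lia) hε hinj hP).trans_eq ?_
    have h1 := ComplexPolygon.area_rescale 1 z
    rw [one_pow, one_mul] at h1
    rw [← h1, ComplexPolygon.area, Finset.sum_div]
    refine Finset.sum_congr rfl fun j _ ↦ ?_
    exact (congrArg (· / 2) (im_conj_mul_toComplex_sub ε (P j) (P (j + 1)) (P 0))).symm
  have hdef : ComplexPolygon.signedDeficit z ≤ deficit P := by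
    rw [ComplexPolygon.signedDeficit, deficit, hperim]
    have := ComplexPolygon.tan_pi_div_pos hn
    gcongr
  rw [hsides, hradii]
  exact (h z).trans (mul_le_mul_of_nonneg_left hdef hC.le)

end PlanePolygon

theorem corollary1p3 (n : ℕ) (hn : 3 ≤ n) :
    ∃ C : ℝ, 0 < C ∧ ∀ P : Polygon PlanePolygon.Plane n, PlanePolygon.IsConvex P →
      PlanePolygon.sideVariance P + PlanePolygon.radiusVariance P ≤
        C * PlanePolygon.deficit P := by
  obtain ⟨C, hC, h⟩ := PlanePolygon.exists_signed_variance_le hn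
  refine ⟨C, hC, fun P ⟨hinj, _, hP⟩ ↦ ?_⟩
  obtain hP | hP := hP
  · exact h P hinj 1 (.inl rfl) fun i j ↦ by simpa using hP i j
  · exact h P hinj (-1) (.inr rfl) fun i j ↦ by simpa using hP i j
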